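/- All spaces are completely regular and Hausdorff. An extension of a space $X$ is a space $Y$ containing $X$ as a dense subspace; its remainder is $Y\setminus X$, and extensions are identified when there is a homeomorphism between them fixing $X$ pointwise. A compactification (pseudocompactification) of $X$ is a compact (pseudocompact) extension of $X$, where a space is pseudocompact if every continuous real-valued function on it is bounded; $\mathscr U(X)$ denotes the set of all pseudocompactifications of $X$ with compact remainder. A space is locally pseudocompact if each of its points has an open neighborhood with pseudocompact closure. Let $\beta X$ be the Stone--Čech compactification and $\upsilon X\subseteq\beta X$ the Hewitt realcompactification of $X$, that is, the intersection of all realcompact $T$ with $X\subseteq T\subseteq\beta X$ (a space is realcompact if it is homeomorphic to a closed subspace of a product of copies of $\mathbb R$). Theorem. Let $X$ be a locally pseudocompact space. Let $\zeta X$ be a compactification of $X$, let $\phi:\beta X\to\zeta X$ continuously extend $\mathrm{id}_X$, and let $E$ be a compact subspace of $\zeta X\setminus X$ containing $\phi[\mathrm{cl}_{\beta X}(\beta X\setminus\upsilon X)]$. Then $Y=X\cup E$, considered as a subspace of $\zeta X$, belongs to $\mathscr U(X)$. Furthermore, every element of $\mathscr U(X)$ is of this form, for some compactification $\zeta X$ of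 $X$, with $\phi:\beta X\to\zeta X$ the continuous extension of $\mathrm{id}_X$, and some such $E$. -/

import Mathlib

universe u v

/-- Every continuous real-valued function is bounded. -/
def IsPseudocompactSpace (Y : Type u) [TopologicalSpace Y] : Prop :=
  ∀ f : Y → ℝ, Continuous f → ∃ M : ℝ, ∀ y, |f y| ≤ M

/-- Every point has an open neighbourhood whose closure is a pseudocompact subspace. -/
def IsLocallyPseudocompactSpace (X : Type u) [TopologicalSpace X] : Prop :=
  ∀ x : X, ∃ U : Set X, IsOpen U ∧ x ∈ U ∧ IsPseudocompactSpace (closure U)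

/-- `T` is homeomorphic to a closed subspace of a product of copies of the real line.
(Index types in the universe of `T` suffice: the continuous real functions on `T` live there.) -/
def IsRealcompactSpace (T : Type u) [TopologicalSpace T] : Prop :=
  ∃ (ι : Type u) (g : T → ι → ℝ), Topology.IsClosedEmbedding g

/-- The Hewitt realcompactification `υX`, as a subset of `βX`: the intersection of all
realcompact `T` with `X ⊆ T ⊆ βX`. -/
def hewittRealcompactification (X : Type u) [TopologicalSpace X] : Set (StoneCech X) :=
  ⋂₀ {T : Set (StoneCech X) |
    Set.range (stoneCechUnit : X → StoneCech X) ⊆ T ∧ IsRealcompactSpace T}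

/-- `Y` is an extension of `X` through `e`: a Tychonoff space (that is, a completely regular
Hausdorff space) in which `e` embeds `X` as a dense subspace. -/
structure IsExtension {X : Type u} {Y : Type v} [TopologicalSpace X] [TopologicalSpace Y]
    (e : X → Y) : Prop where
  tychonoff : T35Space Y
  isDenseEmbedding : IsDenseEmbedding e

/-- A compactification of `X`: a compact extension. -/
structure IsCompactification {X : Type u} {Y : Type v} [TopologicalSpace X] [TopologicalSpace Y]
    (e : X → Y) : Prop extends IsExtension e where
  compact : CompactSpace Y

/-- The extension `e : X → Y` is a pseudocompactification of `X` and its remainder `Y \ X` is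
compact, i.e. it is an element of `𝒰(X)`. -/
structure IsPseudocompactificationWithCompactRemainder {X : Type u} {Y : Type v}
    [TopologicalSpace X] [TopologicalSpace Y] (e : X → Y) : Prop extends IsExtension e where
  pseudocompact : IsPseudocompactSpace Y
  isCompact_remainder : IsCompact (Set.range e)ᶜ

/-- Equivalence of extensions: a homeomorphism which fixes `X` pointwise. -/
def ExtensionEquivalent {X : Type u} {Y Z : Type v} [TopologicalSpace Y] [TopologicalSpace Z]
    (e : X → Y) (i : X → Z) : Prop :=
  ∃ h : Y ≃ₜ Z, ∀ x, h (e x) = i x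

/-- For `i : X → Z` and `E ⊆ Z`, the inclusion of `X` into the subspace `X ∪ E` of `Z`. -/
def inclUnion {X : Type u} {Z : Type v} (i : X → Z) (E : Set Z) :
    X → (Set.range i ∪ E : Set Z) :=
  fun x => ⟨i x, Or.inl ⟨x, rfl⟩⟩

/-- `i : X → Z` is a compactification of `X`, `φ : βX → Z` is the continuous extension of the
identity of `X`, and `E` is a compact subspace of `Z \ X` containing the image under `φ` of
`cl (βX \ υX)`. -/
structure IsAdmissible {X : Type u} {Z : Type v} [TopologicalSpace X] [TopologicalSpace Z]
    (i : X → Z) (φ : StoneCech X → Z) (E : Set Z) : Prop where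
  isCompactification : IsCompactification i
  continuous : Continuous φ
  extends_id : ∀ x, φ (stoneCechUnit x) = i x
  isCompact : IsCompact E
  subset_remainder : E ⊆ (Set.range i)ᶜ
  image_subset : φ '' closure (hewittRealcompactification X)ᶜ ⊆ E

open Filter Topology Set

/-! A point of `βX` lies outside `υX` exactly when some continuous real `f` on `X` tends to infinity
there (`mem_hewittRealcompactification_iff`). An unbounded continuous function on `X ∪ E` would blow
up along `X` at such a point `p`; but `φ p ∈ E`, where the function has a finite value. For the
converse take `ζX = βY` and let `E` be the remainder of `Y`. If `φ p ∉ E` for some `p ∉ υX`, an `f`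
blowing up at `p`, cut off near `E`, extends by zero to an unbounded continuous function on `Y`
(`apply_mem`). -/

/-- The trace on `X` of the neighbourhood filter of a point of `βX`. -/
def stoneCechTrace {X : Type u} [TopologicalSpace X] (p : StoneCech X) : Filter X :=
  comap stoneCechUnit (𝓝 p)

instance stoneCechTrace_neBot {X : Type u} [TopologicalSpace X] (p : StoneCech X) :
    (stoneCechTrace p).NeBot :=
  comap_neBot fun t ht => by
    obtain ⟨_, hx, x, rfl⟩ := mem_closure_iff_nhds.1 (denseRange_stoneCechUnit p) t ht
    exact ⟨x, hx⟩

theorem tendsto_stoneCechTrace {X : Type u} [TopologicalSpace X] {Z : Type v} [TopologicalSpace Z]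
    {i : X → Z} {φ : StoneCech X → Z} (hφ : Continuous φ) (h : ∀ x, φ (stoneCechUnit x) = i x)
    (p : StoneCech X) : Tendsto i (stoneCechTrace p) (𝓝 (φ p)) := by
  have : Tendsto (fun x => φ (stoneCechUnit x)) (stoneCechTrace p) (𝓝 (φ p)) :=
    (hφ.tendsto p).comp tendsto_comap
  simpa only [h] using this

/-- The extension of a real function on `X` to a function from `βX` to `ℝ ∪ {∞}`. -/
noncomputable def onePointExtend {X : Type u} [TopologicalSpace X] (f : C(X, ℝ)) :
    StoneCech X → OnePoint ℝ :=
  stoneCechExtend (OnePoint.continuous_coe.comp f.continuous)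

theorem continuous_onePointExtend {X : Type u} [TopologicalSpace X] (f : C(X, ℝ)) :
    Continuous (onePointExtend f) :=
  continuous_stoneCechExtend _

theorem onePointExtend_stoneCechUnit {X : Type u} [TopologicalSpace X] (f : C(X, ℝ)) (x : X) :
    onePointExtend f (stoneCechUnit x) = (f x : OnePoint ℝ) :=
  stoneCechExtend_stoneCechUnit _ x

theorem tendsto_coe_onePointExtend {X : Type u} [TopologicalSpace X] (f : C(X, ℝ))
    (p : StoneCech X) :
    Tendsto (fun x => (f x : OnePoint ℝ)) (stoneCechTrace p) (𝓝 (onePointExtend f p)) :=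
  tendsto_stoneCechTrace (continuous_onePointExtend f) (onePointExtend_stoneCechUnit f) p

theorem tendsto_cocompact_of_onePointExtend_eq_infty {X : Type u} [TopologicalSpace X]
    {f : C(X, ℝ)} {p : StoneCech X} (h : onePointExtend f p = OnePoint.infty) :
    Tendsto f (stoneCechTrace p) (cocompact ℝ) := by
  have := tendsto_coe_onePointExtend f p
  rw [h] at this
  rw [← coclosedCompact_eq_cocompact, ← OnePoint.comap_coe_nhds_infty]
  exact tendsto_comap_iff.2 this

theorem exists_tendsto_of_onePointExtend_ne_infty {X : Type u} [TopologicalSpace X]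
    {f : C(X, ℝ)} {p : StoneCech X} (h : onePointExtend f p ≠ OnePoint.infty) :
    ∃ r : ℝ, Tendsto f (stoneCechTrace p) (𝓝 r) := by
  obtain ⟨r, hr⟩ := OnePoint.ne_infty_iff_exists.1 h
  have := tendsto_coe_onePointExtend f p
  rw [← hr] at this
  exact ⟨r, OnePoint.isOpenEmbedding_coe.isInducing.tendsto_nhds_iff.2 this⟩

theorem exists_bound_of_onePointExtend_ne_infty {X : Type u} [TopologicalSpace X]
    {f : C(X, ℝ)} (h : ∀ p, onePointExtend f p ≠ OnePoint.infty) : ∃ M : ℝ, ∀ x, |f x| ≤ M := by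
  have hc : IsCompact ((↑) ⁻¹' range (onePointExtend f) : Set ℝ) :=
    (OnePoint.isOpenEmbedding_coe.isInducing.isCompact_preimage_iff (by
      rintro _ ⟨p, rfl⟩
      exact OnePoint.ne_infty_iff_exists.1 (h p))).2
      (isCompact_range (continuous_onePointExtend f))
  obtain ⟨M, hM⟩ := hc.isBounded.exists_norm_le
  exact ⟨M, fun x => hM (f x) ⟨stoneCechUnit x, onePointExtend_stoneCechUnit f x⟩⟩

/-- The finiteness locus in `βX` of a continuous real function on `X` is realcompact. -/
theorem isRealcompactSpace_onePointExtend_preimage {X : Type u} [TopologicalSpace X]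
    (f : C(X, ℝ)) :
    IsRealcompactSpace (onePointExtend f ⁻¹' range ((↑) : ℝ → OnePoint ℝ)) := by
  set T := onePointExtend f ⁻¹' range ((↑) : ℝ → OnePoint ℝ)
  let e : ℝ ≃ₜ range ((↑) : ℝ → OnePoint ℝ) :=
    OnePoint.isOpenEmbedding_coe.isEmbedding.toHomeomorph
  let k : T → ℝ := fun t => e.symm ((range _).restrictPreimage (onePointExtend f) t)
  have hk : IsProperMap k :=
    e.symm.isProperMap.comp
      ((continuous_onePointExtend f).isProperMap.restrictPreimage (range _))
  -- The coordinate `none` makes `g` proper, because `k` already is; the remaining coordinates make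
  -- it injective.
  let g : T → Option C(StoneCech X, ℝ) → ℝ := fun t o => o.elim (k t) (fun c => c t.1)
  have hg : Continuous g := by
    refine continuous_pi fun o => ?_
    cases o with
    | none => exact hk.continuous
    | some c => exact c.continuous.comp continuous_subtype_val
  have hproper : IsProperMap g :=
    isProperMap_of_comp_of_t2 hg (continuous_apply none) hk
  refine ⟨_, g, IsClosedEmbedding.of_continuous_injective_isClosedMap hg ?_ hproper.isClosedMap⟩
  intro s t hst
  by_contra hne
  obtain ⟨c, hc, hcc⟩ := separatesPoints_continuous_of_t35Space (X := StoneCech X)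
    (fun h => hne (Subtype.ext h))
  exact hcc (congrFun hst (some ⟨c, hc⟩))

/-- Finiteness loci are among the realcompact `T` being intersected. Conversely, if every `f` has a
finite limit at `p`, so do all coordinates of a closed embedding of `T`; the limit lies in its
range, and uniqueness of limits in `βX` puts `p` in `T`. -/
theorem mem_hewittRealcompactification_iff {X : Type u} [TopologicalSpace X] {p : StoneCech X} :
    p ∈ hewittRealcompactification X ↔ ∀ f : C(X, ℝ), onePointExtend f p ≠ OnePoint.infty := by
  constructor
  · intro hp f
    refine OnePoint.ne_infty_iff_exists.2 (hp _ ⟨?_, isRealcompactSpace_onePointExtend_preimage f⟩)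
    rintro _ ⟨x, rfl⟩
    exact ⟨f x, (onePointExtend_stoneCechUnit f x).symm⟩
  · rintro h T ⟨hT, ι, g, hg⟩
    let u : X → T := fun x => ⟨stoneCechUnit x, hT ⟨x, rfl⟩⟩
    have hu : Continuous u := continuous_stoneCechUnit.subtype_mk _
    choose r hr using fun j : ι => exists_tendsto_of_onePointExtend_ne_infty
      (h ⟨fun x => g (u x) j, (continuous_apply j).comp (hg.continuous.comp hu)⟩)
    have hlim : Tendsto (fun x => g (u x)) (stoneCechTrace p) (𝓝 r) := tendsto_pi_nhds.2 hr
    obtain ⟨t, rfl⟩ : r ∈ range g :=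
      hg.isClosed_range.mem_of_tendsto hlim (Eventually.of_forall fun x => mem_range_self _)
    have hut : Tendsto u (stoneCechTrace p) (𝓝 t) := hg.isInducing.tendsto_nhds_iff.2 hlim
    have hpt : Tendsto (stoneCechUnit : X → StoneCech X) (stoneCechTrace p) (𝓝 t.1) :=
      (continuous_subtype_val.tendsto t).comp hut
    have hp : Tendsto (stoneCechUnit : X → StoneCech X) (stoneCechTrace p) (𝓝 p) := tendsto_comap
    rw [tendsto_nhds_unique hp hpt]
    exact t.2

theorem isDenseEmbedding_inclUnion {X : Type u} {Z : Type v} [TopologicalSpace X]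
    [TopologicalSpace Z] {i : X → Z} (hi : IsDenseEmbedding i) (E : Set Z) :
    IsDenseEmbedding (inclUnion i E) where
  toIsInducing := IsInducing.subtypeVal.of_comp_iff.1 hi.isInducing
  injective x y h := hi.injective (congrArg Subtype.val h)
  dense := by
    intro y
    rw [closure_subtype, ← range_comp]
    exact hi.dense y.1

theorem range_inclUnion_compl {X : Type u} {Z : Type v} {i : X → Z} {E : Set Z}
    (hE : E ⊆ (range i)ᶜ) : (range (inclUnion i E))ᶜ = Subtype.val ⁻¹' E := by
  ext ⟨z, hz⟩
  constructor
  · intro h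
    refine hz.resolve_left ?_
    rintro ⟨x, rfl⟩
    exact h ⟨x, rfl⟩
  · rintro h ⟨x, hx⟩
    exact hE h ⟨x, congrArg Subtype.val hx⟩

theorem IsAdmissible.isPseudocompactSpace {X : Type u} {Z : Type v} [TopologicalSpace X]
    [TopologicalSpace Z] {i : X → Z} {φ : StoneCech X → Z} {E : Set Z}
    (h : IsAdmissible i φ E) : IsPseudocompactSpace (range i ∪ E : Set Z) := by
  intro f hf
  have hd := isDenseEmbedding_inclUnion h.isCompactification.isDenseEmbedding E
  let f₀ : C(X, ℝ) := ⟨fun x => f (inclUnion i E x), hf.comp hd.continuous⟩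
  obtain ⟨M, hM⟩ : ∃ M : ℝ, ∀ x, |f₀ x| ≤ M := by
    refine exists_bound_of_onePointExtend_ne_infty fun p hp => ?_
    have hpE : φ p ∈ E := h.image_subset ⟨p, subset_closure fun hp' =>
      mem_hewittRealcompactification_iff.1 hp' f₀ hp, rfl⟩
    have hlim : Tendsto (inclUnion i E) (stoneCechTrace p) (𝓝 ⟨φ p, Or.inr hpE⟩) :=
      tendsto_subtype_rng.2 (tendsto_stoneCechTrace h.continuous h.extends_id p)
    exact ((hf.tendsto _).comp hlim).not_tendsto (disjoint_nhds_cocompact _)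
      (tendsto_cocompact_of_onePointExtend_eq_infty hp)
  exact ⟨M, fun y => hd.dense.induction_on y (isClosed_le hf.abs continuous_const) hM⟩

theorem IsAdmissible.isPseudocompactificationWithCompactRemainder {X : Type u} {Z : Type v}
    [TopologicalSpace X] [TopologicalSpace Z] {i : X → Z} {φ : StoneCech X → Z} {E : Set Z}
    (h : IsAdmissible i φ E) : IsPseudocompactificationWithCompactRemainder (inclUnion i E) where
  tychonoff :=
    have := h.isCompactification.tychonoff
    inferInstance
  isDenseEmbedding := isDenseEmbedding_inclUnion h.isCompactification.isDenseEmbedding E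
  pseudocompact := h.isPseudocompactSpace
  isCompact_remainder := by
    rw [range_inclUnion_compl h.subset_remainder]
    refine (IsInducing.subtypeVal.isCompact_preimage_iff ?_).2 h.isCompact
    rw [Subtype.range_coe]
    exact subset_union_right

theorem continuous_extend_zero {X : Type u} {Y : Type v} [TopologicalSpace X] [TopologicalSpace Y]
    {e : X → Y} (he : IsOpenEmbedding e) {f : X → ℝ} (hf : Continuous f)
    (h : ∀ y ∉ range e, ∀ᶠ z in 𝓝 y, ∀ x, e x = z → f x = 0) :
    Continuous (Function.extend e f 0) := by
  refine continuous_iff_continuousAt.2 fun y => ?_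
  by_cases hy : y ∈ range e
  · obtain ⟨x, rfl⟩ := hy
    refine he.continuousAt_iff.1 ?_
    rw [Function.extend_comp he.injective]
    exact hf.continuousAt
  · refine (continuousAt_const (y := (0 : ℝ))).congr ?_
    filter_upwards [h y hy] with z hz
    by_cases hzr : ∃ x, e x = z
    · obtain ⟨x, rfl⟩ := hzr
      rw [he.injective.extend_apply, hz x rfl]
    · rw [Function.extend_apply' _ _ _ hzr, Pi.zero_apply]

/-- A point of `βX \ υX` is sent to the remainder by the extension of a pseudocompactification
with compact remainder. -/
theorem IsPseudocompactificationWithCompactRemainder.apply_mem {X : Type u} {Y : Type v}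
    [TopologicalSpace X] [TopologicalSpace Y] {e : X → Y}
    (h : IsPseudocompactificationWithCompactRemainder e) {φ : StoneCech X → StoneCech Y}
    (hφ : Continuous φ) (hφe : ∀ x, φ (stoneCechUnit x) = stoneCechUnit (e x)) {p : StoneCech X}
    (hp : p ∉ hewittRealcompactification X) : φ p ∈ stoneCechUnit '' (range e)ᶜ := by
  have := h.tychonoff
  by_contra hpE
  obtain ⟨f, hf⟩ : ∃ f : C(X, ℝ), onePointExtend f p = OnePoint.infty := by
    simpa [mem_hewittRealcompactification_iff] using hp
  -- Separation takes place in `βY`, since `φ p` need not lie in `Y`.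
  have hE := (h.isCompact_remainder.image continuous_stoneCechUnit).isClosed
  obtain ⟨w, hw0, hw1, -⟩ := exists_continuous_zero_one_of_isClosed hE
    (isClosed_singleton (x := φ p)) (disjoint_singleton_right.2 hpE)
  have he : IsOpenEmbedding e :=
    ⟨h.isDenseEmbedding.isEmbedding, isClosed_compl_iff.1 h.isCompact_remainder.isClosed⟩
  have hwe : Continuous fun y : Y => w (stoneCechUnit y) :=
    w.continuous.comp continuous_stoneCechUnit
  -- The factor vanishes where `w ≤ 1 / 2`, hence on a whole neighbourhood of the remainder. Near
  -- `p` it is at least `1 / 4`, so `|f| > 4 * M` there forces `|q| > M`.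
  let q : X → ℝ := fun x => max 0 (w (stoneCechUnit (e x)) - 1 / 2) * f x
  have hq : Continuous q :=
    (continuous_const.max ((hwe.comp he.continuous).sub continuous_const)).mul f.continuous
  have hF : Continuous (Function.extend e q 0) := by
    refine continuous_extend_zero he hq fun y hy => ?_
    have hy0 : w (stoneCechUnit y) < 1 / 2 := by
      rw [hw0 ⟨y, hy, rfl⟩]
      norm_num
    filter_upwards [hwe.continuousAt.eventually_lt_const hy0] with z hz x hx
    subst hx
    simp only [q, max_eq_left (sub_nonpos.2 hz.le), zero_mul]
  obtain ⟨M, hM⟩ := h.pseudocompact _ hF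
  have hM' : ∀ x, |q x| ≤ M := fun x => by simpa only [he.injective.extend_apply] using hM (e x)
  have hwp : (3 / 4 : ℝ) < w (φ p) := by
    rw [hw1 rfl]
    norm_num
  have hw : ∀ᶠ x in stoneCechTrace p, 3 / 4 < w (stoneCechUnit (e x)) :=
    ((w.continuous.tendsto _).comp (tendsto_stoneCechTrace hφ hφe p)).eventually_const_lt hwp
  have hfp : ∀ᶠ x in stoneCechTrace p, 4 * M < |f x| :=
    (tendsto_norm_cocompact_atTop.comp
      (tendsto_cocompact_of_onePointExtend_eq_infty hf)).eventually_gt_atTop _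
  obtain ⟨x, hx, hfx⟩ := (hw.and hfp).exists
  have hqx := hM' x
  simp only [q, abs_mul] at hqx
  have h4 : 1 / 4 ≤ |max 0 (w (stoneCechUnit (e x)) - 1 / 2)| :=
    (le_max_of_le_right (by linarith)).trans (le_abs_self _)
  have := mul_le_mul_of_nonneg_right h4 (abs_nonneg (f x))
  linarith

theorem IsPseudocompactificationWithCompactRemainder.isAdmissible {X : Type u} {Y : Type v}
    [TopologicalSpace X] [TopologicalSpace Y] {e : X → Y}
    (h : IsPseudocompactificationWithCompactRemainder e) :
    IsAdmissible (fun x => stoneCechUnit (e x))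
      (stoneCechExtend (continuous_stoneCechUnit.comp h.isDenseEmbedding.continuous))
      (stoneCechUnit '' (range e)ᶜ) := by
  have := h.tychonoff
  have hE := h.isCompact_remainder.image continuous_stoneCechUnit
  refine ⟨⟨⟨inferInstance, ?_⟩, inferInstance⟩, continuous_stoneCechExtend _,
    fun x => stoneCechExtend_stoneCechUnit _ x, hE, ?_, ?_⟩
  · exact ⟨⟨isInducing_stoneCechUnit.comp h.isDenseEmbedding.isInducing,
      denseRange_stoneCechUnit.comp h.isDenseEmbedding.dense continuous_stoneCechUnit⟩,
      injective_stoneCechUnit_of_t35Space.comp h.isDenseEmbedding.injective⟩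
  · rintro _ ⟨y, hy, rfl⟩ ⟨x, hx⟩
    exact hy ⟨x, injective_stoneCechUnit_of_t35Space hx⟩
  -- As `E` is closed, the closure of `βX \ υX` comes for free.
  · refine image_subset_iff.2 (closure_minimal (fun p hp => ?_)
      (hE.isClosed.preimage (continuous_stoneCechExtend _)))
    exact h.apply_mem (continuous_stoneCechExtend _)
      (fun x => stoneCechExtend_stoneCechUnit _ x) hp

theorem extensionEquivalent_inclUnion_of_isEmbedding {X : Type u} {Y Z : Type v}
    [TopologicalSpace Y] [TopologicalSpace Z] {j : Y → Z} (hj : IsEmbedding j) (e : X → Y) :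
    ExtensionEquivalent e (inclUnion (fun x => j (e x)) (j '' (range e)ᶜ)) := by
  have hr : range j = range (fun x => j (e x)) ∪ j '' (range e)ᶜ := by
    rw [show range (fun x => j (e x)) = j '' range e from range_comp j e, ← image_union,
      union_compl_self, image_univ]
  exact ⟨hj.toHomeomorph.trans (Homeomorph.setCongr hr), fun x => Subtype.ext rfl⟩

theorem mainTheorem7 {X : Type u} [TopologicalSpace X] [T35Space X]
    (hX : IsLocallyPseudocompactSpace X) :
    (∀ (Z : Type v) [TopologicalSpace Z] (i : X → Z) (φ : StoneCech X → Z) (E : Set Z),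
      IsAdmissible i φ E →
        IsPseudocompactificationWithCompactRemainder (inclUnion i E)) ∧
    (∀ (Y : Type v) [TopologicalSpace Y] (e : X → Y),
      IsPseudocompactificationWithCompactRemainder e →
        ∃ (Z : Type v) (_ : TopologicalSpace Z) (i : X → Z) (φ : StoneCech X → Z) (E : Set Z),
          IsAdmissible i φ E ∧ ExtensionEquivalent e (inclUnion i E)) := by
  refine ⟨fun Z _ i φ E h => h.isPseudocompactificationWithCompactRemainder, fun Y _ e h => ?_⟩
  have := h.tychonoff
  exact ⟨StoneCech Y, inferInstance, _, _, _, h.isAdmissible,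
    extensionEquivalent_inclUnion_of_isEmbedding isEmbedding_stoneCechUnit e⟩
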